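/- For a prime $p$ and integers $\ell, N \ge 0$, call a set $\mathcal F \subseteq (\mathbb Z/p\mathbb Z)^\ell$ \emph{$\mathbb Z_p$-covering} if for all distinct $v, w \in \mathcal F$ and every $s \in \mathbb Z/p\mathbb Z$ there is a coordinate $i \in \{1,\dots,\ell\}$ with $v_i - w_i = s$. Let $\mathrm{AAM}(p,N)$ be the minimum $\ell$ for which there is a $\mathbb Z_p$-covering set $\mathcal F \subseteq (\mathbb Z/p\mathbb Z)^\ell$ with exactly $N$ elements. \textbf{Theorem.} There are an absolute constant $c > 0$ and thresholds $p_0, N_0$ such that for every prime $p \ge p_0$ and every integer $N \ge N_0$ with $N \le 2^{\,p^{\log_2 \log_2 p}}$, $$\mathrm{AAM}(p,N) \;\le\; p \log_2 p \cdot (\log_2 N)^{\,1 - \frac{c}{\log_2 \log_2 \log_2 N}} .$$ -/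

import Mathlib

namespace AlonAlweiss

/-- The pair `v, w` of vectors over `ℤ/pℤ` is `S`-covering: every `s ∈ S` is a coordinate
difference `v i - w i`. -/
def PairCovering {p l : ℕ} (S : Set (ZMod p)) (v w : Fin l → ZMod p) : Prop :=
  ∀ s ∈ S, ∃ i, v i - w i = s

/-- An `(l, p)`-family (a set of vectors in `(ℤ/pℤ)^l`) is `S`-covering if every pair of distinct
elements of it is `S`-covering. -/
def FamilyCovering {p l : ℕ} (S : Set (ZMod p)) (F : Finset (Fin l → ZMod p)) : Prop :=
  ∀ v ∈ F, ∀ w ∈ F, v ≠ w → PairCovering S v w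

/-- The lengths `l` for which there is a `ℤ/pℤ`-covering `(l, p)`-family of size `N`. -/
def coveringLengths (p N : ℕ) : Set ℕ :=
  {l | ∃ F : Finset (Fin l → ZMod p), F.card = N ∧ FamilyCovering Set.univ F}

/-- The Alon-Alweiss measure: the minimum `l` such that a `ℤ/pℤ`-covering `(l, p)`-family of
size `N` exists (for prime `p` the minimum is attained, see `isLeast_AAM`). -/
noncomputable def AAM (p N : ℕ) : ℕ := sInf (coveringLengths p N)

theorem coveringLengths_nonempty {p : ℕ} (hp : p.Prime) (N : ℕ) :
    (coveringLengths p N).Nonempty := by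
  haveI : Fact p.Prime := ⟨hp⟩
  obtain ⟨e⟩ : Nonempty (Fin (Fintype.card (Fin N × ZMod p)) ≃ Fin N × ZMod p) :=
    ⟨(Fintype.equivFin _).symm⟩
  let f : Fin N → (Fin (Fintype.card (Fin N × ZMod p)) → ZMod p) :=
    fun i x => if (e x).1 = i then (e x).2 else 0
  have hcov : ∀ i j, i ≠ j → ∀ s : ZMod p, ∃ x, f i x - f j x = s := by
    intro i j hij s
    exact ⟨e.symm (i, s), by simp [f, hij]⟩
  have hinj : Function.Injective f := by
    intro i j h
    by_contra hij
    obtain ⟨x, hx⟩ := hcov i j hij 1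
    rw [h, sub_self] at hx
    exact zero_ne_one hx
  refine ⟨_, Finset.univ.map ⟨f, hinj⟩, by simp, ?_⟩
  intro v hv w hw hvw s _
  simp only [Finset.mem_map, Finset.mem_univ, true_and, Function.Embedding.coeFn_mk] at hv hw
  obtain ⟨i, rfl⟩ := hv
  obtain ⟨j, rfl⟩ := hw
  exact hcov i j (fun h => hvw (by rw [h])) s

theorem isLeast_AAM {p : ℕ} (hp : p.Prime) (N : ℕ) : IsLeast (coveringLengths p N) (AAM p N) :=
  ⟨Nat.sInf_mem (coveringLengths_nonempty hp N), fun _ h => Nat.sInf_le h⟩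

end AlonAlweiss

namespace AlonAlweiss

/-! Covering all differences costs about `p` coordinates per bit of `log N`; the saving comes from
covering an interval of `2^k` differences at bounded cost per bit. A base family of `8·2^k` vectors
of length 2 has, for each single difference in the interval, a good colouring with `5·2^k` colours.
Chaining (`GoodColoring.chain`) merges two good colourings into one for the union, replacing vectors
by words of length `m` and colours by words of length `m + 1`. After `k` doublings the whole
interval is handled, and for `m` of order `k^2` the overhead `(1 + 1/m)^k` is so near 1 that vectors
still far outnumber colours; a large colour class is the required family (`exists_interval_family`).
About `p / 2^k` intervals exhaust `ℤ/pℤ`, so the length is `O(p log N / 2^k)` once `m^k ≤ log N`.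
This permits `k` of order `log log N / log log log N`. -/

/-- A colouring `c` of the index type of a family of vectors `f` is `S`-good if distinct members of
the same colour have every `s ∈ S` as a coordinate difference. -/
def GoodColoring {p : ℕ} {T ι Γ : Type} (f : T → ι → ZMod p) (c : T → Γ) (S : Set (ZMod p)) :
    Prop :=
  ∀ x y, x ≠ y → c x = c y → ∀ s ∈ S, ∃ i, f x i - f y i = s

/-- Concatenation of `m` members of a family of vectors. -/
def blockFamily {p : ℕ} {T ι : Type} (m : ℕ) (f : T → ι → ZMod p) :
    (Fin m → T) → (Fin m × ι) → ZMod p :=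
  fun x i => f (x i.1) i.2

/-- The colouring of words which chains the second colour of each letter to the first colour of its
predecessor. -/
def chainColoring {T Γ : Type} [AddCommGroup Γ] (m : ℕ) (c₁ c₂ : T → Γ) :
    (Fin m → T) → Fin (m + 1) → Γ :=
  fun x => (Fin.snoc (fun i => c₂ (x i)) 0 : Fin (m + 1) → Γ) -
    (Fin.cons 0 (fun i => c₁ (x i)) : Fin (m + 1) → Γ)

/-- Entry `j` of the chain colour is `c₂ (x j) - c₁ (x (j - 1))`. At the first difference the
predecessors agree, so the `c₁` term cancels; the last difference is symmetric, with the final entry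
padded by 0. -/
theorem exists_first_difference {T Γ : Type} [AddCommGroup Γ] {m : ℕ} {c₁ c₂ : T → Γ}
    {x y : Fin m → T} (hxy : x ≠ y) (h : chainColoring m c₁ c₂ x = chainColoring m c₁ c₂ y) :
    ∃ j, x j ≠ y j ∧ c₂ (x j) = c₂ (y j) := by
  classical
  obtain ⟨i, hi⟩ := Function.ne_iff.1 hxy
  obtain ⟨j, hj, hmin⟩ := exists_minimal_of_wellFoundedLT (fun j => x j ≠ y j) ⟨i, hi⟩
  refine ⟨j, hj, ?_⟩
  have h' := congrFun h j.castSucc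
  simp only [chainColoring, Pi.sub_apply, Fin.snoc_castSucc] at h'
  obtain ⟨m, rfl⟩ : ∃ m', m = m' + 1 := ⟨m - 1, by have := j.2; omega⟩
  rcases Fin.eq_zero_or_eq_succ j with rfl | ⟨j, rfl⟩
  · simpa using h'
  · have hpre : x j.castSucc = y j.castSucc := by
      by_contra hne
      have := hmin hne (Fin.castSucc_lt_succ (i := j)).le
      exact absurd this (not_le.2 (Fin.castSucc_lt_succ (i := j)))
    rw [← Fin.succ_castSucc, Fin.cons_succ, Fin.cons_succ, hpre] at h'
    exact sub_left_injective h'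

theorem exists_last_difference {T Γ : Type} [AddCommGroup Γ] {m : ℕ} {c₁ c₂ : T → Γ}
    {x y : Fin m → T} (hxy : x ≠ y) (h : chainColoring m c₁ c₂ x = chainColoring m c₁ c₂ y) :
    ∃ j, x j ≠ y j ∧ c₁ (x j) = c₁ (y j) := by
  classical
  obtain ⟨i, hi⟩ := Function.ne_iff.1 hxy
  obtain ⟨j, hj, hmax⟩ := exists_maximal_of_wellFoundedGT (fun j => x j ≠ y j) ⟨i, hi⟩
  refine ⟨j, hj, ?_⟩
  have h' := congrFun h j.succ
  simp only [chainColoring, Pi.sub_apply, Fin.cons_succ] at h'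
  obtain ⟨m, rfl⟩ : ∃ m', m = m' + 1 := ⟨m - 1, by have := j.2; omega⟩
  rcases Fin.eq_castSucc_or_eq_last j with ⟨j, rfl⟩ | rfl
  · have hpost : x j.succ = y j.succ := by
      by_contra hne
      have := hmax hne (Fin.castSucc_lt_succ (i := j)).le
      exact absurd this (not_le.2 (Fin.castSucc_lt_succ (i := j)))
    rw [Fin.succ_castSucc, Fin.snoc_castSucc, Fin.snoc_castSucc, hpost] at h'
    exact sub_right_injective h'
  · rw [Fin.succ_last, Fin.snoc_last, Fin.snoc_last] at h'
    exact sub_right_injective h'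

theorem GoodColoring.chain {p : ℕ} {T ι Γ : Type} [AddCommGroup Γ] {f : T → ι → ZMod p}
    {c₁ c₂ : T → Γ} {S₁ S₂ : Set (ZMod p)} (h₁ : GoodColoring f c₁ S₁)
    (h₂ : GoodColoring f c₂ S₂) (m : ℕ) :
    GoodColoring (blockFamily m f) (chainColoring m c₁ c₂) (S₁ ∪ S₂) := by
  rintro x y hxy hc s (hs | hs)
  · obtain ⟨j, hj, hcj⟩ := exists_last_difference hxy hc
    obtain ⟨i, hi⟩ := h₁ _ _ hj hcj s hs
    exact ⟨(j, i), hi⟩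
  · obtain ⟨j, hj, hcj⟩ := exists_first_difference hxy hc
    obtain ⟨i, hi⟩ := h₂ _ _ hj hcj s hs
    exact ⟨(j, i), hi⟩

theorem exists_goodColoring_biUnion {p : ℕ} {α T ι Γ : Type} [Fintype T] [Fintype ι]
    [AddCommGroup Γ] [Fintype Γ] (f : T → ι → ZMod p) (A : Set α) (S : α → Set (ZMod p))
    (hS : ∀ a ∈ A, ∃ c : T → Γ, GoodColoring f c (S a)) (m k : ℕ) :
    ∃ (T' ι' Γ' : Type) (_ : Fintype T') (_ : Fintype ι') (_ : AddCommGroup Γ') (_ : Fintype Γ')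
      (f' : T' → ι' → ZMod p),
      Fintype.card T' = Fintype.card T ^ m ^ k ∧ Fintype.card ι' = m ^ k * Fintype.card ι ∧
      Fintype.card Γ' = Fintype.card Γ ^ (m + 1) ^ k ∧
      ∀ B : Finset α, (B : Set α) ⊆ A → B.card ≤ 2 ^ k →
        ∃ c : T' → Γ', GoodColoring f' c (⋃ a ∈ B, S a) := by
  classical
  induction k with
  | zero =>
    refine ⟨T, ι, Γ, inferInstance, inferInstance, inferInstance, inferInstance, f, by simp,
      by simp, by simp, fun B hB hcard => ?_⟩
    rcases B.eq_empty_or_nonempty with rfl | ⟨a, ha⟩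
    · exact ⟨fun _ => 0, fun x y _ _ s hs => by simp at hs⟩
    · obtain rfl : B = {a} := Finset.eq_singleton_iff_unique_mem.2
        ⟨ha, fun b hb => Finset.card_le_one.1 (by simpa using hcard) b hb a ha⟩
      simpa using hS a (hB ha)
  | succ k ih =>
    obtain ⟨T', ι', Γ', _, _, _, _, f', hT, hι, hΓ, h⟩ := ih
    refine ⟨Fin m → T', Fin m × ι', Fin (m + 1) → Γ', inferInstance, inferInstance,
      inferInstance, inferInstance, blockFamily m f', ?_, ?_, ?_, fun B hB hcard => ?_⟩
    · rw [Fintype.card_fun, hT, Fintype.card_fin, ← pow_mul, pow_succ]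
    · rw [Fintype.card_prod, hι, Fintype.card_fin, pow_succ]; ring
    · rw [Fintype.card_fun, hΓ, Fintype.card_fin, ← pow_mul, pow_succ]
    -- Split `B` into two parts of size at most `2 ^ k` and chain their colourings.
    · obtain ⟨C, hCB, hC⟩ := Finset.exists_subset_card_eq (min_le_right (2 ^ k) B.card)
      obtain ⟨c₁, h₁⟩ := h C (fun a ha => hB (hCB ha)) (hC.trans_le (min_le_left _ _))
      obtain ⟨c₂, h₂⟩ := h (B \ C) (fun a ha => hB (Finset.sdiff_subset ha)) (by
        rw [Finset.card_sdiff_of_subset hCB, hC, pow_succ] at *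
        omega)
      have := h₁.chain h₂ m
      rw [← Finset.set_biUnion_union, Finset.union_sdiff_of_subset hCB] at this
      exact ⟨_, this⟩

/-! ### The base family and large colour classes -/

/-- The vectors `(a + εu, -(a + εu))` for `ε ∈ {0, 1}` and `a < 4K`. -/
def twoIntervals (p K : ℕ) (u : ZMod p) : Bool × Fin (4 * K) → Bool → ZMod p :=
  fun x b => (if b then 1 else -1) * ((x.2 : ℕ) + if x.1 then u else 0)

/-- Colour `(1, a)` by `a` and `(0, a)` by `a + t`: a colour clash pairs `a + t + u` with `a`. The
two signs serve the two orders of the pair. -/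
theorem exists_goodColoring_twoIntervals (p : ℕ) {K t : ℕ} (ht : t < K) (u : ZMod p) :
    ∃ c : Bool × Fin (4 * K) → ZMod (5 * K),
      GoodColoring (twoIntervals p K u) c {u + (t : ZMod p)} := by
  let d : Bool × Fin (4 * K) → ℕ := fun x => x.2 + if x.1 then 0 else t
  have hd : ∀ x, d x < 5 * K := by
    intro x
    have := x.2.2
    simp only [d]
    split_ifs <;> omega
  refine ⟨fun x => (d x : ZMod (5 * K)), ?_⟩
  rintro x y hxy hc s rfl
  have hdd : d x = d y := by
    have := congrArg ZMod.val hc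
    rwa [ZMod.val_cast_of_lt (hd x), ZMod.val_cast_of_lt (hd y)] at this
  obtain ⟨e, a⟩ := x
  obtain ⟨e', a'⟩ := y
  simp only [d] at hdd
  cases e <;> cases e' <;> simp only [Bool.false_eq_true, if_true, if_false] at hdd
  · exact absurd (congrArg (Prod.mk _) (Fin.ext (by omega))) hxy
  · refine ⟨false, ?_⟩
    have : ((a' : ℕ) : ZMod p) = (a : ℕ) + t := by exact_mod_cast congrArg Nat.cast hdd.symm
    simp [twoIntervals, this]; ring
  · refine ⟨true, ?_⟩
    have : ((a : ℕ) : ZMod p) = (a' : ℕ) + t := by exact_mod_cast congrArg Nat.cast hdd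
    simp [twoIntervals, this]; ring
  · exact absurd (congrArg (Prod.mk _) (Fin.ext (by omega))) hxy

theorem GoodColoring.exists_family {p : ℕ} {T ι Γ : Type} [Fintype T] [Fintype Γ] [Nonempty Γ]
    {f : T → ι → ZMod p} {c : T → Γ} {S : Set (ZMod p)} (h : GoodColoring f c S) {M : ℕ}
    (hM : M * Fintype.card Γ ≤ Fintype.card T) :
    ∃ g : Fin M → ι → ZMod p, ∀ x y, x ≠ y → ∀ s ∈ S, ∃ i, g x i - g y i = s := by
  classical
  obtain ⟨b, -, hb⟩ := Finset.exists_le_card_fiber_of_mul_le_card_of_maps_to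
    (s := (Finset.univ : Finset T)) (t := (Finset.univ : Finset Γ)) (f := c) (n := M)
    (fun _ _ => Finset.mem_univ _) Finset.univ_nonempty
    (by simpa [mul_comm] using hM)
  obtain ⟨e⟩ : Nonempty (Fin M ↪ {x ∈ (Finset.univ : Finset T) | c x = b}) :=
    Function.Embedding.nonempty_of_card_le (by rw [Fintype.card_fin, Fintype.card_coe]; exact hb)
  refine ⟨fun x => f (e x), fun x y hxy => h _ _ (fun he => hxy (e.injective (Subtype.ext he))) ?_⟩
  rw [(Finset.mem_filter.1 (e x).2).2, (Finset.mem_filter.1 (e y).2).2]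

/-- Bernoulli for `(1 - 1/(m + 1))^k`, with `m = 8k(k + 3)` making `m + 1 - k ≥ 4k(k + 3)`. -/
theorem pow_add_one_sub_pow_le (k : ℕ) (hk : 1 ≤ k) :
    4 * (k + 3) * ((8 * k * (k + 3) + 1) ^ k - (8 * k * (k + 3)) ^ k) ≤
      (8 * k * (k + 3)) ^ k := by
  set m := 8 * k * (k + 3) with hm
  have hB : ((m : ℝ) + 1 - k) * (m + 1) ^ k ≤ m ^ k * (m + 1) := by
    have hm0 : (0 : ℝ) < m + 1 := by positivity
    have h := one_add_mul_le_pow (a := -(1 / ((m : ℝ) + 1))) (by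
      have : 1 / ((m : ℝ) + 1) ≤ 1 := by
        rw [div_le_one hm0]; linarith [(Nat.cast_nonneg m : (0 : ℝ) ≤ m)]
      linarith) k
    have e : 1 + -(1 / ((m : ℝ) + 1)) = m / (m + 1) := by field_simp; ring
    rw [e, div_pow, le_div_iff₀ (by positivity)] at h
    have : ((m : ℝ) + 1 - k) * (m + 1) ^ k
        = (1 + k * -(1 / ((m : ℝ) + 1))) * (m + 1) ^ k * (m + 1) := by
      field_simp; ring
    rw [this]
    gcongr
  have hle : m ^ k ≤ (m + 1) ^ k := Nat.pow_le_pow_left (by omega) k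
  obtain ⟨D, hD⟩ := Nat.exists_eq_add_of_le hle
  rw [hD, Nat.add_sub_cancel_left]
  have hD' : ((m : ℝ) + 1) ^ k = m ^ k + D := by exact_mod_cast hD
  rw [hD'] at hB
  have hk' : (1 : ℝ) ≤ k := by exact_mod_cast hk
  have hmr : (m : ℝ) = 8 * k * (k + 3) := by rw [hm]; push_cast; ring
  have hDB : ((m : ℝ) + 1 - k) * D ≤ k * m ^ k := by nlinarith
  have h2 : (k * (4 * (k + 3)) : ℝ) * D ≤ k * m ^ k := by
    refine le_trans (mul_le_mul_of_nonneg_right ?_ (Nat.cast_nonneg D)) hDB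
    rw [hmr]; nlinarith
  have h3 : (4 * (k + 3) : ℝ) * D ≤ m ^ k := by
    rw [mul_assoc] at h2
    exact le_of_mul_le_mul_left h2 (by linarith)
  exact_mod_cast h3

theorem two_pow_mul_colors_le (k : ℕ) (hk : 1 ≤ k) :
    2 ^ ((8 * k * (k + 3)) ^ k / 4) * (5 * 2 ^ k) ^ (8 * k * (k + 3) + 1) ^ k ≤
      (2 * (4 * 2 ^ k)) ^ (8 * k * (k + 3)) ^ k := by
  have hD := pow_add_one_sub_pow_le k hk
  set m := 8 * k * (k + 3) with hm
  obtain ⟨D, hD'⟩ := Nat.exists_eq_add_of_le (Nat.pow_le_pow_left (Nat.le_succ m) k)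
  rw [Nat.succ_eq_add_one] at hD'
  rw [hD', Nat.add_sub_cancel_left] at hD
  obtain ⟨M, hM⟩ : 4 ∣ m ^ k :=
    dvd_pow (Dvd.intro (2 * k * (k + 3)) (by rw [hm]; ring)) (by omega)
  rw [hD', hM, Nat.mul_div_cancel_left _ (by norm_num)]
  rw [hM] at hD
  -- The `D` surplus colour letters cost at most `k + 3` bits each. Since `4 * 5 ^ 4 ≤ 8 ^ 4`, there
  -- is room for this factor `2 ^ M` and for the desired one.
  have h1 : (5 * 2 ^ k) ^ D ≤ 2 ^ M := by
    calc (5 * 2 ^ k) ^ D ≤ (2 ^ (k + 3)) ^ D := by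
          refine Nat.pow_le_pow_left ?_ D
          rw [pow_add]; omega
      _ = 2 ^ ((k + 3) * D) := by rw [pow_mul]
      _ ≤ 2 ^ M := Nat.pow_le_pow_right (by norm_num) (by nlinarith)
  calc 2 ^ M * (5 * 2 ^ k) ^ (4 * M + D)
      = 2 ^ M * (5 * 2 ^ k) ^ (4 * M) * (5 * 2 ^ k) ^ D := by rw [pow_add]; ring
    _ ≤ 2 ^ M * (5 * 2 ^ k) ^ (4 * M) * 2 ^ M := by gcongr
    _ = (2 * 2 * 5 ^ 4 * (2 ^ k) ^ 4) ^ M := by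
        rw [pow_mul, mul_pow 5 (2 ^ k) 4, mul_pow, mul_pow, mul_pow, mul_pow]; ring
    _ ≤ (8 ^ 4 * (2 ^ k) ^ 4) ^ M := by gcongr; norm_num
    _ = (2 * (4 * 2 ^ k)) ^ (4 * M) := by
        rw [pow_mul]; congr 1; rw [← mul_pow]; congr 1; ring

theorem exists_interval_family (p k : ℕ) (hk : 1 ≤ k) (u : ZMod p) :
    ∃ g : Fin (2 ^ ((8 * k * (k + 3)) ^ k / 4)) → Fin ((8 * k * (k + 3)) ^ k * 2) → ZMod p,
      ∀ x y, x ≠ y → ∀ t : ℕ, t < 2 ^ k → ∃ i, g x i - g y i = u + (t : ZMod p) := by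
  have : NeZero (5 * 2 ^ k) := ⟨by positivity⟩
  obtain ⟨T, ι, Γ, _, _, _, _, f, hT, hι, hΓ, h⟩ :=
    exists_goodColoring_biUnion (Γ := ZMod (5 * 2 ^ k)) (twoIntervals p (2 ^ k) u)
      {t : ℕ | t < 2 ^ k} (fun t => {u + (t : ZMod p)})
      (fun t ht => exists_goodColoring_twoIntervals p ht u) (8 * k * (k + 3)) k
  obtain ⟨c, hc⟩ := h (Finset.range (2 ^ k)) (fun t ht => by simpa using ht) (by simp)
  obtain ⟨g, hg⟩ := hc.exists_family (M := 2 ^ ((8 * k * (k + 3)) ^ k / 4)) (by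
    rw [hT, hΓ]
    simpa [ZMod.card] using two_pow_mul_colors_le k hk)
  have e : Fin ((8 * k * (k + 3)) ^ k * 2) ≃ ι :=
    (Fintype.equivFinOfCardEq (by simpa using hι)).symm
  refine ⟨fun x i => g x (e i), fun x y hxy t ht => ?_⟩
  obtain ⟨i, hi⟩ := hg x y hxy (u + t) (by
    simp only [Set.mem_iUnion]
    exact ⟨t, by simpa using ht, rfl⟩)
  exact ⟨e.symm i, by simpa using hi⟩

theorem AAM_le_card {p N : ℕ} (hp : p.Prime) {A ι : Type} [Fintype A] [Fintype ι]
    (f : A → ι → ZMod p) (hf : ∀ a b, a ≠ b → ∀ s, ∃ i, f a i - f b i = s)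
    (hN : N ≤ Fintype.card A) : AAM p N ≤ Fintype.card ι := by
  classical
  have : Fact p.Prime := ⟨hp⟩
  let e := Fintype.equivFin ι
  let g : A → Fin (Fintype.card ι) → ZMod p := fun a i => f a (e.symm i)
  have hg : ∀ a b, a ≠ b → ∀ s, ∃ i, g a i - g b i = s := fun a b hab s => by
    obtain ⟨i, hi⟩ := hf a b hab s
    exact ⟨e i, by simpa [g] using hi⟩
  have hinj : Function.Injective g := by
    intro a b h
    by_contra hab
    obtain ⟨i, hi⟩ := hg a b hab 1
    rw [h, sub_self] at hi
    exact zero_ne_one hi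
  obtain ⟨B, -, hB⟩ := Finset.exists_subset_card_eq (s := (Finset.univ : Finset A)) hN
  refine Nat.sInf_le ⟨B.map ⟨g, hinj⟩, by simpa using hB, ?_⟩
  intro v hv w hw hvw s _
  simp only [Finset.mem_map, Function.Embedding.coeFn_mk] at hv hw
  obtain ⟨a, -, rfl⟩ := hv
  obtain ⟨b, -, rfl⟩ := hw
  exact hg a b (fun h => hvw (by rw [h])) s

theorem AAM_le {p N k L : ℕ} (hp : p.Prime) (hk : 1 ≤ k)
    (hN : N ≤ (2 ^ ((8 * k * (k + 3)) ^ k / 4)) ^ L) :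
    AAM p N ≤ L * ((p / 2 ^ k + 1) * ((8 * k * (k + 3)) ^ k * 2)) := by
  have : Fact p.Prime := ⟨hp⟩
  choose g hg using fun r : Fin (p / 2 ^ k + 1) =>
    exists_interval_family p k hk (((r : ℕ) * 2 ^ k : ℕ) : ZMod p)
  have := AAM_le_card (N := N) hp
    (A := Fin L → Fin (2 ^ ((8 * k * (k + 3)) ^ k / 4)))
    (ι := Fin L × Fin (p / 2 ^ k + 1) × Fin ((8 * k * (k + 3)) ^ k * 2))
    (fun a i => g i.2.1 (a i.1) i.2.2) (fun a b hab s => ?_) (by simpa using hN)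
  · simpa using this
  · obtain ⟨j, hj⟩ := Function.ne_iff.1 hab
    obtain ⟨i, hi⟩ := hg ⟨s.val / 2 ^ k, by
      -- The quotient of `s.val` by `2 ^ k` selects the interval, the remainder the place in it.
      have := Nat.div_le_div_right (c := 2 ^ k) (ZMod.val_lt s).le
      omega⟩ (a j) (b j) hj (s.val % 2 ^ k) (Nat.mod_lt _ (by positivity))
    refine ⟨(j, _, i), hi.trans ?_⟩
    rw [← Nat.cast_add, mul_comm, Nat.div_add_mod, ZMod.natCast_zmod_val]

theorem AAM_real_bound {p N k : ℕ} (hp : p.Prime) (hk : 1 ≤ k) (hkp : 2 ^ k ≤ p) {n : ℝ}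
    (hN : (N : ℝ) ≤ 2 ^ n) (hn : (((8 * k * (k + 3)) ^ k : ℕ) : ℝ) ≤ n) :
    (AAM p N : ℝ) ≤ 20 * n * p / 2 ^ k := by
  set M := (8 * k * (k + 3)) ^ k with hM
  have hM4 : 4 ∣ M := dvd_pow (Dvd.intro (2 * k * (k + 3)) (by ring)) (by omega)
  have hMpos : 0 < M := by positivity
  have hMr : (0 : ℝ) < M := by exact_mod_cast hMpos
  have hn0 : 0 < n := hMr.trans_le hn
  set L := ⌈4 * n / M⌉₊ with hL
  have hL1 : 4 * n / M ≤ L := Nat.le_ceil _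
  have hL2 : (L : ℝ) ≤ 5 * n / M := by
    have h1 := (Nat.ceil_lt_add_one (a := 4 * n / M) (by positivity)).le
    have h2 : 1 ≤ n / M := (one_le_div hMr).2 hn
    calc (L : ℝ) ≤ 4 * n / M + n / M := by linarith
      _ = 5 * n / M := by ring
  have hNL : N ≤ (2 ^ (M / 4)) ^ L := by
    have h1 : n ≤ ((M / 4 * L : ℕ) : ℝ) := by
      rw [Nat.cast_mul, Nat.cast_div hM4 (by norm_num)]
      rw [div_le_iff₀ hMr] at hL1
      push_cast
      linarith
    have h2 : (N : ℝ) ≤ 2 ^ (M / 4 * L) := by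
      rw [← Real.rpow_natCast]
      exact hN.trans (Real.rpow_le_rpow_of_exponent_le (by norm_num) h1)
    rw [← pow_mul]
    exact_mod_cast h2
  have hA : (AAM p N : ℝ) ≤ L * (((p / 2 ^ k : ℕ) + 1) * (M * 2)) := by
    exact_mod_cast AAM_le hp hk hNL
  have hG : ((p / 2 ^ k : ℕ) : ℝ) + 1 ≤ 2 * p / 2 ^ k := by
    have h1 : ((p / 2 ^ k : ℕ) : ℝ) ≤ p / 2 ^ k := by exact_mod_cast Nat.cast_div_le (α := ℝ)
    have h2 : (1 : ℝ) ≤ p / 2 ^ k := (one_le_div (by positivity)).2 (by exact_mod_cast hkp)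
    calc _ ≤ (p : ℝ) / 2 ^ k + p / 2 ^ k := add_le_add h1 h2
      _ = _ := by ring
  calc (AAM p N : ℝ) ≤ 5 * n / M * ((2 * p / 2 ^ k) * (M * 2)) :=
        hA.trans (by gcongr)
    _ = _ := by field_simp; ring

/-! ### Choice of `k` and asymptotics -/

theorem three_mul_logb_two_le {y : ℝ} (hy : 16 ≤ y) : 3 * Real.logb 2 y ≤ y := by
  have h1 := Real.log_le_sub_one_of_pos (show 0 < y / 16 by linarith)
  have h2 : Real.log y = Real.log (y / 16) + 4 * Real.log 2 := by
    rw [Real.log_div (by linarith) (by norm_num), show (16 : ℝ) = 2 ^ 4 by norm_num,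
      Real.log_pow]
    push_cast; ring
  have h3 := Real.log_two_gt_d9
  rw [Real.logb, ← mul_div_assoc, div_le_iff₀ (by linarith)]
  nlinarith

/-- With `P = log p`, this turns the upper bound on `N` into `2 ^ k ≤ p`. -/
theorem div_logb_two_le {y P : ℝ} (hP : 2 ≤ P) (hy : 16 ≤ y) (h : y ≤ P * Real.logb 2 P) :
    y / (3 * Real.logb 2 y) ≤ P := by
  have hz : 4 ≤ Real.logb 2 y := by
    rw [Real.le_logb_iff_rpow_le (by norm_num) (by linarith)]
    norm_num; exact hy
  rw [div_le_iff₀ (by linarith)]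
  rcases le_total y P with hyP | hyP
  · nlinarith
  · have : Real.logb 2 P ≤ Real.logb 2 y :=
      Real.logb_le_logb_of_le (by norm_num) (by linarith) hyP
    nlinarith

theorem AAM_le_of_logb_bounds {p N : ℕ} (hp : p.Prime) {P n y z : ℝ}
    (hP : P = Real.logb 2 p) (hn : n = Real.logb 2 N) (hy : y = Real.logb 2 n)
    (hz : z = Real.logb 2 y) (hP40 : 40 ≤ P) (hN : 0 < N) (hn0 : 0 < n) (hy16 : 16 ≤ y)
    (hyP : y ≤ P * Real.logb 2 P) :
    (AAM p N : ℝ) ≤ p * P * n ^ (1 - 1 / 3 / z) := by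
  have hp0 : (0 : ℝ) < p := by exact_mod_cast hp.pos
  have hz4 : 4 ≤ z := by
    rw [hz, Real.le_logb_iff_rpow_le (by norm_num) (by linarith)]
    norm_num; exact hy16
  have hpP : (2 : ℝ) ^ P = p := by
    rw [hP]; exact Real.rpow_logb (by norm_num) (by norm_num) hp0
  have hnN : (2 : ℝ) ^ n = N := by
    rw [hn]; exact Real.rpow_logb (by norm_num) (by norm_num) (by exact_mod_cast hN)
  have hyn : (2 : ℝ) ^ y = n := by
    rw [hy]; exact Real.rpow_logb (by norm_num) (by norm_num) hn0
  have hzy : (2 : ℝ) ^ z = y := by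
    rw [hz]; exact Real.rpow_logb (by norm_num) (by norm_num) (by linarith)
  have hw1 : 1 ≤ y / (3 * z) := by
    rw [one_le_div (by linarith), hz]
    exact three_mul_logb_two_le hy16
  have hwP : y / (3 * z) ≤ P := by
    rw [hz]; exact div_logb_two_le (by linarith) hy16 hyP
  set k := ⌊y / (3 * z)⌋₊ with hk
  have hk1 : 1 ≤ k := Nat.le_floor (by exact_mod_cast hw1)
  have hk1' : (1 : ℝ) ≤ k := by exact_mod_cast hk1
  have hkw : (k : ℝ) ≤ y / (3 * z) := Nat.floor_le (by linarith)
  have hwk : y / (3 * z) < k + 1 := Nat.lt_floor_add_one _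
  have hkp : 2 ^ k ≤ p := by
    have : (2 : ℝ) ^ k ≤ p := by
      rw [← hpP, ← Real.rpow_natCast]
      exact Real.rpow_le_rpow_of_exponent_le (by norm_num) (hkw.trans hwP)
    exact_mod_cast this
  have hkz : k * (3 * z) ≤ y := (le_div_iff₀ (by linarith)).1 hkw
  -- The base is at most `y ^ 2 = 2 ^ (2z)`, and `2kz ≤ y`: hence the 3 in the choice of `k`.
  have hM : (((8 * k * (k + 3)) ^ k : ℕ) : ℝ) ≤ n := by
    have h12 : 12 * (k : ℝ) ≤ y := by nlinarith
    have h1 : (8 * k * (k + 3) : ℝ) ≤ y ^ 2 := by nlinarith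
    push_cast
    calc (8 * k * (k + 3) : ℝ) ^ k ≤ (y ^ 2) ^ k := by gcongr
      _ = (2 : ℝ) ^ (z * (2 * k)) := by
        rw [← pow_mul, Real.rpow_mul (by norm_num), hzy, ← Real.rpow_natCast]
        push_cast; rfl
      _ ≤ 2 ^ y := Real.rpow_le_rpow_of_exponent_le (by norm_num) (by nlinarith)
      _ = n := hyn
  refine (AAM_real_bound hp hk1 hkp hnN.ge hM).trans ?_
  have hexp : n ^ (1 - 1 / 3 / z) = n / 2 ^ (y / (3 * z)) := by
    rw [Real.rpow_sub hn0, Real.rpow_one]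
    congr 1
    rw [← hyn, ← Real.rpow_mul (by norm_num)]
    congr 1
    field_simp
  -- Rounding `k` down loses a factor 2; with the 20 of `AAM_real_bound` it gives 40, absorbed by
  -- `P`.
  have h2k : (2 : ℝ) ^ (y / (3 * z)) ≤ 2 ^ k * 2 := by
    rw [← pow_succ, ← Real.rpow_natCast]
    exact Real.rpow_le_rpow_of_exponent_le (by norm_num) (by push_cast; exact hwk.le)
  rw [hexp, ← mul_div_assoc, div_le_div_iff₀ (by positivity) (by positivity)]
  calc 20 * n * p * (2 : ℝ) ^ (y / (3 * z)) ≤ 20 * n * p * (2 ^ k * 2) := by gcongr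
    _ = p * 40 * n * 2 ^ k := by ring
    _ ≤ p * P * n * 2 ^ k := by gcongr

end AlonAlweiss

theorem mainTheorem3 :
    ∃ c : ℝ, 0 < c ∧ ∃ p₀ N₀ : ℕ, ∀ p N : ℕ, p.Prime → p₀ ≤ p → N₀ ≤ N →
      (N : ℝ) ≤ (2 : ℝ) ^ ((p : ℝ) ^ Real.logb 2 (Real.logb 2 (p : ℝ))) →
      (AlonAlweiss.AAM p N : ℝ) ≤
        (p : ℝ) * Real.logb 2 (p : ℝ) *
          (Real.logb 2 (N : ℝ)) ^
            (1 - c / Real.logb 2 (Real.logb 2 (Real.logb 2 (N : ℝ)))) := by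
  have hlim : Filter.Tendsto (fun N : ℕ => Real.logb 2 (N : ℝ)) Filter.atTop Filter.atTop :=
    (Real.tendsto_logb_atTop (by norm_num)).comp tendsto_natCast_atTop_atTop
  obtain ⟨N₁, hN₁⟩ := Filter.eventually_atTop.1 (hlim.eventually_ge_atTop ((2 : ℝ) ^ (16 : ℝ)))
  refine ⟨1 / 3, by norm_num, 2 ^ 40, N₁ + 1, fun p N hp hp₀ hN hNp => ?_⟩
  have hp0 : (0 : ℝ) < p := by exact_mod_cast hp.pos
  have hN0 : 0 < N := by omega
  have hn := hN₁ N (by omega)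
  have hn0 : 0 < Real.logb 2 (N : ℝ) := lt_of_lt_of_le (by positivity) hn
  refine AlonAlweiss.AAM_le_of_logb_bounds hp rfl rfl rfl rfl ?_ hN0 hn0 ?_ ?_
  · rw [Real.le_logb_iff_rpow_le (by norm_num) hp0]
    exact_mod_cast hp₀
  · rwa [Real.le_logb_iff_rpow_le (by norm_num) hn0]
  · have h1 : Real.logb 2 (N : ℝ) ≤ (p : ℝ) ^ Real.logb 2 (Real.logb 2 (p : ℝ)) := by
      rwa [Real.logb_le_iff_le_rpow (by norm_num) (by exact_mod_cast hN0)]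
    have h2 := Real.logb_le_logb_of_le (b := 2) (by norm_num) hn0 h1
    rwa [Real.logb_rpow_eq_mul_logb_of_pos hp0, mul_comm] at h2
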